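/- **Compactness Theorem.** For a metric space $(X,d)$ with basepoint $*$ put $(x\cdot y)=\tfrac12\big(d(*,x)+d(*,y)-d(x,y)\big)$; $(X,*)$ is $\delta$-hyperbolic ($\delta\ge 0$) if $(x\cdot y)\ge\min\big((x\cdot z),(y\cdot z)\big)-\delta$ for all $x,y,z\in X$. Let $X$ be a non-empty proper $\delta$-hyperbolic metric space (for some basepoint) that is geodesic or, more generally, coarsely geodesic: there is $C\ge 0$ such that for all $x,y\in X$ and $t\in[0,d(x,y)]$ some $z\in X$ satisfies $|d(x,z)-t|\le C$ and $|d(z,y)-(d(x,y)-t)|\le C$. (Geodesic spaces satisfy this with $C=0$, word metrics on finitely generated groups with $C=1$.) Assume that $\mathrm{Isom}(X)$ acts cocompactly on $X$, i.e. there is a compact $K\subset X$ whose $\mathrm{Isom}(X)$-translates cover $X$. Let $G$ be a group with a finite generating set $S$, and let $\rho_i:G\to\mathrm{Isom}(X)$, $i=1,2,\dots$, be representations that are non-elementary, i.e. $\rho_i(G)$ fixes no point of the Gromov boundary of $X$ (no class of sequences $(u_n)$ in $X$ with $(u_m\cdot u_n)\to\infty$, where $(u_n)\sim(v_n)$ if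 $(u_m\cdot v_n)\to\infty$ as $m,n\to\infty$). Then, after passing to a subsequence, one of the following holds. 1. There are isometries $\phi_i\in\mathrm{Isom}(X)$ such that the conjugates $g\mapsto\phi_i\rho_i(g)\phi_i^{-1}$ converge in the compact-open topology to a representation $\rho:G\to\mathrm{Isom}(X)$. 2. For each $i$ there is a point $x_i\in X$, not fixed by $\rho_i(G)$, that is centrally located for $\rho_i$ and $S$, i.e. at which the function $x\mapsto\max_{g\in S}d(x,\rho_i(g)x)$ attains its global minimum, such that the based $G$-spaces $(X,x_i,\rho_i)$ converge to a based $G$-space $(T,*,\rho)$, where $T$ is an $\mathbb R$-tree and the isometric action $\rho$ of $G$ on $T$ has no global fixed point. Here a based $G$-space $(Y,*,\rho)$ is a metric space $Y$ with an isometric action $\rho$ of $G$ and a basepoint $*$ not fixed by all of $G$. It induces the $G$-equivariant, not identically zero pseudometric $d(g,h)=d_Y(\rho(g)*,\rho(h)*)$ on $G$, and convergence of based $G$-spaces means convergence of the classes of these pseudometrics in the space of all $G$-equivariant, not identically zero pseudometrics on the discrete group $G$ (with the compact-open topology, i.e. pointwise convergence) modulo scaling by positive reals, with the quotient topology. An $\mathbb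 R$-tree is a metric space in which any two points are joined by a unique arc and this arc is a geodesic segment. -/

import Mathlib

universe u v

open Filter Topology
open scoped NNReal

/-! ### Arcs, geodesic segments, real trees -/

/-- `A` is an arc from `x` to `y`: the image of a topological embedding of a closed interval
(possibly a single point) with these endpoints. -/
def IsArc {X : Type*} [MetricSpace X] (A : Set X) (x y : X) : Prop :=
  ∃ (a b : ℝ) (hab : a ≤ b) (α : Set.Icc a b → X), IsEmbedding α ∧
    α ⟨a, Set.left_mem_Icc.2 hab⟩ = x ∧ α ⟨b, Set.right_mem_Icc.2 hab⟩ = y ∧ Set.range α = A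

/-- `A` is a geodesic segment from `x` to `y`: the image of an isometric embedding of a closed
interval with these endpoints. -/
def IsGeodesicSegment {X : Type*} [MetricSpace X] (A : Set X) (x y : X) : Prop :=
  ∃ (a b : ℝ) (hab : a ≤ b) (α : Set.Icc a b → X), Isometry α ∧
    α ⟨a, Set.left_mem_Icc.2 hab⟩ = x ∧ α ⟨b, Set.right_mem_Icc.2 hab⟩ = y ∧ Set.range α = A

/-- Any two points are joined by a unique arc, and this arc is a geodesic segment. -/
def IsRTree (X : Type*) [MetricSpace X] : Prop :=
  ∀ x y : X, (∃! A : Set X, IsArc A x y) ∧ ∀ A : Set X, IsArc A x y → IsGeodesicSegment A x y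

/-! ### Hyperbolicity and points at infinity -/

/-- The Gromov product `(x · y)` with respect to the basepoint `o`. -/
noncomputable def gromovProduct {X : Type*} [MetricSpace X] (o x y : X) : ℝ :=
  (dist o x + dist o y - dist x y) / 2

/-- The based metric space `(X, o)` is `δ`-hyperbolic. -/
def IsGromovHyperbolic {X : Type*} [MetricSpace X] (δ : ℝ) (o : X) : Prop :=
  0 ≤ δ ∧ ∀ x y z : X,
    min (gromovProduct o x z) (gromovProduct o y z) - δ ≤ gromovProduct o x y

/-- `X` is geodesic up to a bounded error, i.e. it has no big holes. Geodesic spaces satisfy this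
with `C = 0`, word metrics on finitely generated groups with `C = 1`. -/
def IsCoarselyGeodesic (X : Type*) [MetricSpace X] : Prop :=
  ∃ C : ℝ, ∀ x y : X, ∀ t ∈ Set.Icc (0 : ℝ) (dist x y), ∃ z : X,
    |dist x z - t| ≤ C ∧ |dist z y - (dist x y - t)| ≤ C

/-- `(u m · v n) → ∞` as `m, n → ∞`. For `v = u` this says that `u` converges to a point at
infinity, and for two such sequences that their points at infinity coincide. -/
def AsymptoticAtInfinity {X : Type*} [MetricSpace X] (o : X) (u v : ℕ → X) : Prop :=
  Tendsto (fun p : ℕ × ℕ => gromovProduct o (u p.1) (v p.2)) atTop atTop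

/-- The action `ρ` fixes a point at infinity of `X`, i.e. the class of some sequence `u` that
converges to infinity (in the sense of Gromov). -/
def FixesPointAtInfinity {G X : Type*} [Group G] [MetricSpace X] (o : X)
    (ρ : G →* (X ≃ᵢ X)) : Prop :=
  ∃ u : ℕ → X, AsymptoticAtInfinity o u u ∧
    ∀ g : G, AsymptoticAtInfinity o (fun n => ρ g (u n)) u

def IsNonElementary {G X : Type*} [Group G] [MetricSpace X] (o : X)
    (ρ : G →* (X ≃ᵢ X)) : Prop :=
  ¬ FixesPointAtInfinity o ρ

/-- There is a compact set whose translates under the isometry group cover `X`. -/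
def IsomActsCocompactly (X : Type*) [MetricSpace X] : Prop :=
  ∃ K : Set X, IsCompact K ∧ (⋃ φ : X ≃ᵢ X, φ '' K) = Set.univ

/-! ### Centrally located points -/

/-- `F(x) = max_{g ∈ S} d(x, ρ(g) x)`, with values in `[0, ∞)`. -/
noncomputable def maxDisplacement {G X : Type*} [Group G] [MetricSpace X] (S : Finset G)
    (ρ : G →* (X ≃ᵢ X)) (x : X) : ℝ≥0 :=
  S.sup fun g => nndist x (ρ g x)

def IsCentrallyLocated {G X : Type*} [Group G] [MetricSpace X] (S : Finset G)
    (ρ : G →* (X ≃ᵢ X)) (x : X) : Prop :=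
  ∀ y : X, maxDisplacement S ρ x ≤ maxDisplacement S ρ y

/-! ### Convergence of representations -/

/-- The conjugate representation `g ↦ φ ρ(g) φ⁻¹`. -/
def conjRep {G X : Type*} [Group G] [MetricSpace X] (ρ : G →* (X ≃ᵢ X)) (φ : X ≃ᵢ X) :
    G →* (X ≃ᵢ X) :=
  (MulAut.conj φ).toMonoidHom.comp ρ

/-- An isometry as an element of `C(X, X)`, which carries the compact-open topology. -/
def isomToContinuousMap {X : Type*} [MetricSpace X] (f : X ≃ᵢ X) : C(X, X) :=
  ⟨f, f.continuous⟩

/-- Convergence in the compact-open topology: as `G` is discrete, this is convergence of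
`σ i g` to `τ g` in the compact-open topology, for each `g`. -/
def ConvergesCompactOpen {G X : Type*} [Group G] [MetricSpace X]
    (σ : ℕ → G →* (X ≃ᵢ X)) (τ : G →* (X ≃ᵢ X)) : Prop :=
  ∀ g : G, Tendsto (fun i => isomToContinuousMap (σ i g)) atTop (𝓝 (isomToContinuousMap (τ g)))

/-! ### Projectivized equivariant distance functions and convergence of based `G`-spaces -/

/-- `d` is a `G`-equivariant pseudometric on `G` that is not identically `0`. -/
structure IsEquivariantDist {G : Type*} [Group G] (d : G → G → ℝ) : Prop where
  nonneg : ∀ a b, 0 ≤ d a b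
  self : ∀ a, d a a = 0
  symm : ∀ a b, d a b = d b a
  triangle : ∀ a b c, d a c ≤ d a b + d b c
  equivariant : ∀ g a b, d (g * a) (g * b) = d a b
  nonzero : ∃ a b, d a b ≠ 0

/-- The space of equivariant distance functions on the discrete group `G`. It has the subspace
topology of the product topology, which is the compact-open topology since `G` is discrete. -/
abbrev EquivDist (G : Type*) [Group G] : Type _ :=
  {d : G → G → ℝ // IsEquivariantDist d}

/-- Two equivariant distance functions are equivalent if they differ by a positive factor. -/
instance equivDistSetoid (G : Type*) [Group G] : Setoid (EquivDist G) where
  r d e := ∃ c : ℝ, 0 < c ∧ ∀ a b, e.1 a b = c * d.1 a b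
  iseqv :=
    { refl := fun d => ⟨1, one_pos, fun a b => (one_mul _).symm⟩
      symm := by
        rintro d e ⟨c, hc, h⟩
        refine ⟨c⁻¹, inv_pos.2 hc, fun a b => ?_⟩
        rw [h, inv_mul_cancel_left₀ hc.ne']
      trans := by
        rintro d e f ⟨c, hc, h⟩ ⟨c', hc', h'⟩
        refine ⟨c' * c, mul_pos hc' hc, fun a b => ?_⟩
        rw [h', h, mul_assoc] }

/-- The space of projectivized equivariant distance functions, with the quotient topology. -/
abbrev ProjEquivDist (G : Type*) [Group G] : Type _ :=
  Quotient (equivDistSetoid G)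

/-- A based `G`-space structure on the metric space `X`: an isometric action together with a
basepoint that is not fixed by the whole group. -/
structure BasedGSpace (G X : Type*) [Group G] [MetricSpace X] where
  action : G →* (X ≃ᵢ X)
  base : X
  base_moved : ∃ g : G, action g base ≠ base

/-- The distance function `d(g, h) = d_X(ρ(g) *, ρ(h) *)` induced by a based `G`-space. -/
noncomputable def BasedGSpace.inducedDist {G X : Type*} [Group G] [MetricSpace X]
    (B : BasedGSpace G X) : EquivDist G :=
  ⟨fun g h => dist (B.action g B.base) (B.action h B.base),
    { nonneg := fun _ _ => dist_nonneg
      self := fun _ => dist_self _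
      symm := fun _ _ => dist_comm _ _
      triangle := fun _ _ _ => dist_triangle _ _ _
      equivariant := fun g a b => by
        simp only [map_mul, IsometryEquiv.mul_apply, IsometryEquiv.dist_eq]
      nonzero := by
        obtain ⟨g, hg⟩ := B.base_moved
        refine ⟨g, 1, ?_⟩
        simpa using hg }⟩

/-- A sequence of based `G`-spaces converges to a based `G`-space if the classes of the induced
distance functions converge in the space of projectivized equivariant distance functions. -/
def BasedGSpace.ConvergesTo {G T : Type*} {X : ℕ → Type*} [Group G] [∀ i, MetricSpace (X i)]
    [MetricSpace T] (A : ∀ i, BasedGSpace G (X i)) (B : BasedGSpace G T) : Prop :=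
  Tendsto (fun i => (Quotient.mk (equivDistSetoid G) (A i).inducedDist : ProjEquivDist G)) atTop
    (𝓝 (Quotient.mk (equivDistSetoid G) B.inducedDist : ProjEquivDist G))

/-!
The displacement function of a non-elementary representation has bounded sublevel sets: a sequence
in a sublevel set tending to infinity has a subsequence converging to a point at infinity, and that
point would be fixed, since every `g` moves the sequence by a bounded amount. By properness the
displacement is therefore minimized at some `x i`. If the minima are bounded along a subsequence,
conjugate `x i` into a fixed compact set; then all orbits are bounded and an Arzelà–Ascoli argument
gives a limit representation. If the minima `r i` tend to infinity, rescale `X` by `1 / r i`. The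
hyperbolicity and coarse geodesicity constants tend to `0`, so the asymptotic cone centered at the
`x i` is a geodesic space satisfying the four-point condition, which is a real tree. Every point of
the `i`-th rescaled space has displacement at least `1`, so the limiting action has no fixed point.
The subtree spanned by the orbit of the limit of the `x i` is the space `T`: the cone itself lives
in the universe of `X`, but this subtree injects into `G × ℝ`.
-/

/-! ### Four-point spaces and real trees -/

/-- The four-point inequality with zero defect, which characterizes the metric subspaces of real
trees. -/
def FourPointCondition (Y : Type*) [PseudoMetricSpace Y] : Prop :=
  ∀ x y z w : Y, dist x y + dist z w ≤ max (dist x z + dist y w) (dist x w + dist y z)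

/-- Between any two points there are points at all intermediate distances: the exact form of
`IsCoarselyGeodesic`. -/
def HasIntermediatePoints (Y : Type*) [PseudoMetricSpace Y] : Prop :=
  ∀ x y : Y, ∀ t ∈ Set.Icc (0 : ℝ) (dist x y), ∃ z : Y, dist x z = t ∧ dist z y = dist x y - t

/-- The metric interval `[x, y]`: all points for which the triangle inequality between `x` and `y`
is an equality. In a real tree this is the segment from `x` to `y`. -/
def metricInterval {Y : Type*} [PseudoMetricSpace Y] (x y : Y) : Set Y :=
  {z | dist x z + dist z y = dist x y}

section MetricInterval

variable {Y : Type*} [PseudoMetricSpace Y] {x y z w : Y}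

theorem mem_metricInterval : z ∈ metricInterval x y ↔ dist x z + dist z y = dist x y := Iff.rfl

theorem left_mem_metricInterval : x ∈ metricInterval x y := by simp [mem_metricInterval]

theorem right_mem_metricInterval : y ∈ metricInterval x y := by simp [mem_metricInterval]

theorem metricInterval_comm (x y : Y) : metricInterval x y = metricInterval y x := by
  ext z
  rw [mem_metricInterval, mem_metricInterval, add_comm, dist_comm x z, dist_comm z y, dist_comm x y]

theorem metricInterval_subset_of_right_mem (hz : z ∈ metricInterval x y) :
    metricInterval x z ⊆ metricInterval x y := fun w hw => by
  rw [mem_metricInterval] at hz hw ⊢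
  linarith [dist_triangle w z y, dist_triangle x w y]

theorem map_mem_metricInterval_iff {T : Type*} [PseudoMetricSpace T] {f : T → Y}
    (hf : Isometry f) {a b c : T} :
    f c ∈ metricInterval (f a) (f b) ↔ c ∈ metricInterval a b := by
  simp only [mem_metricInterval, hf.dist_eq]

end MetricInterval

theorem HasIntermediatePoints.of_isometry {T Y : Type*} [PseudoMetricSpace T] [PseudoMetricSpace Y]
    {f : T → Y} (hf : Isometry f) (hY : HasIntermediatePoints Y)
    (hconv : ∀ s t, metricInterval (f s) (f t) ⊆ Set.range f) : HasIntermediatePoints T := by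
  intro s t c hc
  rw [← hf.dist_eq] at hc
  obtain ⟨z, hsz, hzt⟩ := hY (f s) (f t) c hc
  obtain ⟨u, rfl⟩ := hconv s t (mem_metricInterval.2 (by rw [hsz, hzt, add_sub_cancel]))
  rw [hf.dist_eq] at hsz
  rw [hf.dist_eq, hf.dist_eq] at hzt
  exact ⟨u, hsz, hzt⟩

theorem IsGeodesicSegment.isArc {Y : Type*} [MetricSpace Y] {A : Set Y} {x y : Y}
    (hA : IsGeodesicSegment A x y) : IsArc A x y := by
  obtain ⟨a, b, hab, α, hα, hends⟩ := hA
  exact ⟨a, b, hab, α, hα.isEmbedding, hends⟩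

theorem IsArc.isPreconnected {Y : Type*} [MetricSpace Y] {A : Set Y} {x y : Y}
    (hA : IsArc A x y) : IsPreconnected A := by
  obtain ⟨a, b, -, α, hα, -, -, rfl⟩ := hA
  have : PreconnectedSpace (Set.Icc a b) := Subtype.preconnectedSpace isPreconnected_Icc
  exact isPreconnected_range hα.continuous

theorem IsArc.left_mem {Y : Type*} [MetricSpace Y] {A : Set Y} {x y : Y} (hA : IsArc A x y) :
    x ∈ A := by
  obtain ⟨_, _, _, _, _, hx, _, rfl⟩ := hA
  exact ⟨_, hx⟩

theorem IsArc.right_mem {Y : Type*} [MetricSpace Y] {A : Set Y} {x y : Y} (hA : IsArc A x y) :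
    y ∈ A := by
  obtain ⟨_, _, _, _, _, _, hy, rfl⟩ := hA
  exact ⟨_, hy⟩

theorem IsArc.eq_of_isPreconnected_of_subset {Y : Type*} [MetricSpace Y] {A B : Set Y} {x y : Y}
    (hA : IsArc A x y) (hB : IsPreconnected B) (hBA : B ⊆ A) (hx : x ∈ B) (hy : y ∈ B) :
    B = A := by
  obtain ⟨a, b, hab, α, hα, rfl, rfl, rfl⟩ := hA
  have hpre : IsPreconnected (α ⁻¹' B) := by
    rwa [← hα.isInducing.isPreconnected_image, Set.image_preimage_eq_of_subset hBA]
  exact hBA.antisymm (Set.range_subset_iff.2 fun t => hpre.Icc_subset hx hy ⟨t.2.1, t.2.2⟩)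

namespace FourPointCondition

section PseudoMetric

variable {Y : Type*} [PseudoMetricSpace Y] {x y z : Y}

theorem of_isometry {T : Type*} [PseudoMetricSpace T] {f : T → Y} (hf : Isometry f)
    (hY : FourPointCondition Y) : FourPointCondition T := fun x y z w => by
  simpa only [hf.dist_eq] using hY (f x) (f y) (f z) (f w)

theorem dist_le_of_mem_metricInterval (hY : FourPointCondition Y) (hz : z ∈ metricInterval x y)
    (w : Y) : dist z w ≤ max (dist x w - dist x z) (dist w y - dist z y) := by
  have hfour := hY x y z w
  rw [mem_metricInterval] at hz
  rw [le_max_iff, dist_comm y w, dist_comm y z] at hfour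
  rw [le_max_iff]
  exact hfour.symm.imp (fun h => by linarith) fun h => by linarith

theorem metricInterval_subset_union (hY : FourPointCondition Y) (x y c : Y) :
    metricInterval x y ⊆ metricInterval x c ∪ metricInterval c y := fun z hz => by
  have hxc := dist_triangle x z c
  have hcy := dist_triangle c z y
  rw [dist_comm c z] at hcy
  rw [Set.mem_union, mem_metricInterval, mem_metricInterval, dist_comm c z]
  exact (le_max_iff.1 (hY.dist_le_of_mem_metricInterval hz c)).imp (fun h => by linarith)
    fun h => by linarith

end PseudoMetric

variable {Y : Type*} [MetricSpace Y] {x y z w : Y}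

theorem eq_of_mem_metricInterval (hY : FourPointCondition Y) (hz : z ∈ metricInterval x y)
    (hw : w ∈ metricInterval x y) (hd : dist x z = dist x w) : z = w := by
  have hle := hY.dist_le_of_mem_metricInterval hz w
  rw [mem_metricInterval] at hz hw
  have hd' : dist w y - dist z y = 0 := by linarith
  rw [hd, sub_self, hd', max_self] at hle
  exact dist_le_zero.1 hle

theorem dist_eq_of_mem_metricInterval (hY : FourPointCondition Y) (hz : z ∈ metricInterval x y)
    (hw : w ∈ metricInterval x y) : dist z w = |dist x z - dist x w| := by
  refine le_antisymm ?_ (by simpa only [dist_comm x] using abs_dist_sub_le z w x)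
  have hle := hY.dist_le_of_mem_metricInterval hz w
  rw [mem_metricInterval] at hz hw
  rwa [show dist w y - dist z y = -(dist x w - dist x z) by linarith, ← abs_eq_max_neg,
    abs_sub_comm] at hle

theorem isGeodesicSegment_metricInterval (hY : FourPointCondition Y)
    (hI : HasIntermediatePoints Y) (x y : Y) : IsGeodesicSegment (metricInterval x y) x y := by
  choose γ hxγ hγy using fun t : Set.Icc (0 : ℝ) (dist x y) => hI x y t.1 t.2
  have hmem : ∀ t, γ t ∈ metricInterval x y := fun t => by
    rw [mem_metricInterval, hxγ, hγy, add_sub_cancel]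
  refine ⟨0, dist x y, dist_nonneg, γ, Isometry.of_dist_eq fun s t => ?_, ?_, ?_, ?_⟩
  · rw [hY.dist_eq_of_mem_metricInterval (hmem s) (hmem t), hxγ, hxγ, Subtype.dist_eq,
      Real.dist_eq]
  · exact (dist_eq_zero.1 (hxγ _)).symm
  · exact dist_eq_zero.1 ((hγy _).trans (sub_self _))
  · refine (Set.range_subset_iff.2 hmem).antisymm fun z hz => ?_
    have hle : dist x z ≤ dist x y := by
      linarith [mem_metricInterval.1 hz, dist_nonneg (x := z) (y := y)]
    exact ⟨⟨dist x z, dist_nonneg, hle⟩, hY.eq_of_mem_metricInterval (hmem _) hz (hxγ _)⟩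

/-- In the complement of a point `z`, positivity of the Gromov product based at `z` is an open
equivalence relation; its classes are the branches at `z`. -/
theorem metricInterval_subset_of_isPreconnected (hY : FourPointCondition Y) {A : Set Y}
    (hA : IsPreconnected A) (hx : x ∈ A) (hy : y ∈ A) : metricInterval x y ⊆ A := by
  intro z hz
  by_contra hzA
  suffices hxy : dist x y < dist z x + dist z y by
    rw [← mem_metricInterval.1 hz, dist_comm x z] at hxy
    exact hxy.false
  refine hA.induction₂ (fun u w => dist u w < dist z u + dist z w) (fun u hu => ?_)
    (fun u v w _ _ _ huv hvw => ?_) (fun u w _ _ huw => ?_) hx hy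
  · have hpos : 0 < dist z u := dist_pos.2 fun hzu => hzA (hzu ▸ hu)
    have hopen : IsOpen {w | dist u w < dist z u + dist z w} :=
      isOpen_lt (by fun_prop) (by fun_prop)
    refine mem_nhdsWithin_of_mem_nhds (hopen.mem_nhds ?_)
    rw [Set.mem_ofPred_eq, dist_self]
    positivity
  · have hfour := hY u w z v
    rw [le_max_iff, dist_comm u z, dist_comm w v, dist_comm w z] at hfour
    rcases hfour with h | h <;> linarith
  · rwa [dist_comm w u, add_comm]

theorem isArc_iff (hY : FourPointCondition Y) (hI : HasIntermediatePoints Y) {A : Set Y} :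
    IsArc A x y ↔ A = metricInterval x y := by
  have hgeod := hY.isGeodesicSegment_metricInterval hI x y
  refine ⟨fun hA => ?_, fun hA => hA ▸ hgeod.isArc⟩
  exact (hA.eq_of_isPreconnected_of_subset hgeod.isArc.isPreconnected
    (hY.metricInterval_subset_of_isPreconnected hA.isPreconnected hA.left_mem hA.right_mem)
    left_mem_metricInterval right_mem_metricInterval).symm

theorem isRTree (hY : FourPointCondition Y) (hI : HasIntermediatePoints Y) : IsRTree Y := by
  intro x y
  simp only [hY.isArc_iff hI, existsUnique_eq, forall_eq, true_and]
  exact hY.isGeodesicSegment_metricInterval hI x y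

end FourPointCondition

/-! ### Isometric actions -/

/-- The representation by isometries given by an action by isometric maps. Surjectivity is not
asked for: it comes from the inverses in `G`. -/
def isometryRep {G Y : Type*} [Group G] [MetricSpace Y] (t : G → Y → Y)
    (hisom : ∀ g, Isometry (t g)) (hone : ∀ y, t 1 y = y)
    (hmul : ∀ g h y, t (g * h) y = t g (t h y)) : G →* (Y ≃ᵢ Y) where
  toFun g := IsometryEquiv.mk' (t g) (t g⁻¹)
    (fun y => by rw [← hmul, mul_inv_cancel, hone]) (hisom g)
  map_one' := IsometryEquiv.ext hone
  map_mul' g h := IsometryEquiv.ext (hmul g h)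

theorem exists_rep_of_isometry {G T Y : Type*} [Group G] [MetricSpace T] [PseudoMetricSpace Y]
    (a : G →* (Y ≃ᵢ Y)) {f : T → Y} (hf : Isometry f) (hinv : ∀ g t, a g (f t) ∈ Set.range f) :
    ∃ b : G →* (T ≃ᵢ T), ∀ g t, f (b g t) = a g (f t) := by
  choose act hact using hinv
  refine ⟨isometryRep act (fun g => Isometry.of_dist_eq fun s t => ?_)
    (fun t => hf.injective ?_) (fun g h t => hf.injective ?_), hact⟩
  · rw [← hf.dist_eq, hact, hact, IsometryEquiv.dist_eq, hf.dist_eq]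
  · rw [hact, map_one, IsometryEquiv.coe_one, id]
  · rw [hact, hact, hact, map_mul, IsometryEquiv.mul_apply]

theorem exists_isometry_range_eq_of_small {Y : Type v} [MetricSpace Y] (A : Set Y)
    [Small.{u} A] : ∃ (T : Type u) (_ : MetricSpace T) (f : T → Y),
      Isometry f ∧ Set.range f = A := by
  have hinj : Function.Injective fun t : Shrink.{u} A => ((equivShrink A).symm t : Y) :=
    Subtype.val_injective.comp (equivShrink A).symm.injective
  refine ⟨Shrink.{u} A, MetricSpace.induced _ hinj inferInstance, _, fun _ _ => rfl, ?_⟩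
  rw [← Function.comp_def Subtype.val, (equivShrink A).symm.surjective.range_comp,
    Subtype.range_coe]

/-! ### The subtree spanned by an orbit -/

section OrbitTree

variable {G Y : Type*} [Group G]

/-- The union of the intervals from `p` to the points of its orbit. In a four-point space this is
convex and invariant: it is the subtree spanned by the orbit. -/
def orbitTree [PseudoMetricSpace Y] (a : G →* (Y ≃ᵢ Y)) (p : Y) : Set Y :=
  ⋃ g : G, metricInterval p (a g p)

namespace FourPointCondition

theorem metricInterval_subset_orbitTree [PseudoMetricSpace Y] (hY : FourPointCondition Y)
    (a : G →* (Y ≃ᵢ Y)) (p : Y) {x y : Y} (hx : x ∈ orbitTree a p) (hy : y ∈ orbitTree a p) :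
    metricInterval x y ⊆ orbitTree a p := by
  have hstar : ∀ w ∈ orbitTree a p, metricInterval p w ⊆ orbitTree a p := fun w hw => by
    obtain ⟨g, hg⟩ := Set.mem_iUnion.1 hw
    exact (metricInterval_subset_of_right_mem hg).trans (Set.subset_iUnion_of_subset g subset_rfl)
  refine (hY.metricInterval_subset_union x y p).trans (Set.union_subset ?_ (hstar y hy))
  rw [metricInterval_comm]
  exact hstar x hx

theorem apply_mem_orbitTree [PseudoMetricSpace Y] (hY : FourPointCondition Y)
    (a : G →* (Y ≃ᵢ Y)) (p : Y) (g : G) {z : Y} (hz : z ∈ orbitTree a p) :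
    a g z ∈ orbitTree a p := by
  have horbit : ∀ h : G, a h p ∈ orbitTree a p := fun h =>
    Set.mem_iUnion_of_mem h right_mem_metricInterval
  obtain ⟨h, hh⟩ := Set.mem_iUnion.1 hz
  refine hY.metricInterval_subset_orbitTree a p (horbit g) (horbit (g * h)) ?_
  rwa [map_mul, IsometryEquiv.mul_apply, map_mem_metricInterval_iff (a g).isometry]

theorem small_orbitTree {G : Type u} [Group G] [MetricSpace Y] (hY : FourPointCondition Y)
    (a : G →* (Y ≃ᵢ Y)) (p : Y) : Small.{u} (orbitTree a p) := by
  choose q hq using fun z : orbitTree a p => Set.mem_iUnion.1 z.2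
  refine small_of_injective (f := fun z => (q z, dist p z.1)) fun z w hzw => ?_
  obtain ⟨hqzw, hd⟩ := Prod.ext_iff.1 hzw
  have hw := hq w
  rw [← show q z = q w from hqzw] at hw
  exact Subtype.ext (hY.eq_of_mem_metricInterval (hq z) hw hd)

theorem exists_orbit_basedGSpace {G : Type u} {Y : Type v} [Group G] [MetricSpace Y]
    (hY : FourPointCondition Y) (hI : HasIntermediatePoints Y) (a : G →* (Y ≃ᵢ Y)) (p : Y)
    (hfix : ∀ y : Y, ∃ g : G, a g y ≠ y) :
    ∃ (T : Type u) (_ : MetricSpace T) (B : BasedGSpace G T), IsRTree T ∧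
      (∀ g h : G, B.inducedDist.1 g h = dist (a g p) (a h p)) ∧
      ∀ t : T, ∃ g : G, B.action g t ≠ t := by
  have := hY.small_orbitTree a p
  obtain ⟨T, _, f, hf, hrange⟩ := exists_isometry_range_eq_of_small.{u} (orbitTree a p)
  have hmem : ∀ t, f t ∈ orbitTree a p := fun t => hrange ▸ Set.mem_range_self t
  obtain ⟨b, hb⟩ := exists_rep_of_isometry a hf fun g t =>
    hrange ▸ hY.apply_mem_orbitTree a p g (hmem t)
  obtain ⟨base, rfl⟩ : p ∈ Set.range f :=
    hrange ▸ Set.mem_iUnion_of_mem 1 left_mem_metricInterval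
  have hmoved : ∀ t, ∃ g : G, b g t ≠ t := fun t => by
    obtain ⟨g, hg⟩ := hfix (f t)
    exact ⟨g, fun hfixed => hg (by rw [← hb, hfixed])⟩
  have hconv : ∀ s t, metricInterval (f s) (f t) ⊆ Set.range f := fun s t =>
    hrange ▸ hY.metricInterval_subset_orbitTree a _ (hmem s) (hmem t)
  refine ⟨T, _, ⟨b, base, hmoved base⟩, (hY.of_isometry hf).isRTree (hI.of_isometry hf hconv),
    fun g h => ?_, hmoved⟩
  rw [← hb, ← hb, hf.dist_eq]
  rfl

end FourPointCondition

end OrbitTree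

/-! ### Ultralimits and subsequences -/

theorem exists_tendsto_of_eventually_mem_isCompact {ι Y : Type*} [TopologicalSpace Y]
    (U : Ultrafilter ι) {K : Set Y} (hK : IsCompact K) {f : ι → Y} (hf : ∀ᶠ i in U, f i ∈ K) :
    ∃ a ∈ K, Tendsto f U (𝓝 a) :=
  hK.ultrafilter_le_nhds' (U.map f) hf

theorem exists_subseq_tendsto_of_tendsto_hyperfilter {Y : Type*} [TopologicalSpace Y]
    [FirstCountableTopology Y] {f : ℕ → Y} {a : Y} (hf : Tendsto f (hyperfilter ℕ) (𝓝 a)) :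
    ∃ k : ℕ → ℕ, StrictMono k ∧ Tendsto (f ∘ k) atTop (𝓝 a) :=
  (hf.mapClusterPt.mono Nat.hyperfilter_le_atTop).tendsto_subseq

theorem exists_subseq_le_or_tendsto_atTop {α : Type*} [LinearOrder α] [NoMaxOrder α]
    (f : ℕ → α) :
    (∃ M, ∃ k : ℕ → ℕ, StrictMono k ∧ ∀ i, f (k i) ≤ M) ∨ Tendsto f atTop atTop := by
  by_cases hM : ∃ M, ∃ᶠ i in atTop, f i ≤ M
  · obtain ⟨M, hM⟩ := hM
    exact Or.inl ⟨M, extraction_of_frequently_atTop hM⟩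
  · simp only [not_exists, not_frequently, not_le] at hM
    exact Or.inr (tendsto_atTop.2 fun M => (hM M).mono fun _ => le_of_lt)

theorem countable_of_closure_eq_top {G : Type*} [Group G] {S : Set G} [Countable S]
    (hS : Subgroup.closure S = ⊤) : Countable G := by
  rw [FreeGroup.closure_eq_range, MonoidHom.range_eq_top] at hS
  exact (hS.comp Quot.mk_surjective).countable

/-! ### Points at infinity of hyperbolic spaces -/

section Hyperbolic

variable {X : Type*} [MetricSpace X] {δ : ℝ} {o : X}

theorem gromovProduct_comm (o x y : X) : gromovProduct o x y = gromovProduct o y x := by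
  rw [gromovProduct, gromovProduct, add_comm (dist o x), dist_comm x y]

theorem min_add_le_max_min_add_max_min (a b c d : ℝ) :
    min (a + b) (c + d) ≤ max (min a d) (min c b) + max (min a c) (min d b) := by
  grind

theorem IsGromovHyperbolic.four_point (hX : IsGromovHyperbolic δ o) (x y z w : X) :
    dist x y + dist z w ≤ max (dist x z + dist y w) (dist x w + dist y z) + 4 * δ := by
  have hxy := max_le (hX.2 x y z) (hX.2 x y w)
  have hzw := max_le (hX.2 z w x) (hX.2 z w y)
  rw [max_sub_sub_right] at hxy hzw
  simp only [gromovProduct_comm o z x, gromovProduct_comm o w x, gromovProduct_comm o z y,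
    gromovProduct_comm o w y] at hzw
  have hmin := min_add_le_max_min_add_max_min (gromovProduct o x z) (gromovProduct o y w)
    (gromovProduct o x w) (gromovProduct o y z)
  have hsum : min (gromovProduct o x z + gromovProduct o y w)
      (gromovProduct o x w + gromovProduct o y z) - 2 * δ ≤
      gromovProduct o x y + gromovProduct o z w := by linarith
  rw [sub_le_iff_le_add, min_le_iff] at hsum
  rw [← sub_le_iff_le_add, le_max_iff]
  simp only [gromovProduct] at hsum
  exact hsum.imp (fun h => by linarith) fun h => by linarith

theorem gromovProduct_sub_dist_le (o x y z : X) :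
    gromovProduct o x y - dist x z ≤ gromovProduct o z y := by
  have hz := dist_triangle_right o x z
  have hy := dist_triangle_left z y x
  simp only [gromovProduct]
  linarith

theorem AsymptoticAtInfinity.of_dist_le {u v w : ℕ → X} (huv : AsymptoticAtInfinity o u v) {D : ℝ}
    (hD : ∀ n, dist (u n) (w n) ≤ D) : AsymptoticAtInfinity o w v :=
  tendsto_atTop_mono
    (fun p => (sub_le_sub_left (hD p.1) _).trans (gromovProduct_sub_dist_le o _ _ _))
    (tendsto_atTop_add_const_right _ (-D) huv)

theorem sub_le_gromovProduct_of_coarse_mem_segment {C t : ℝ} {y z : X} (ζ : X)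
    (ht : |dist o z - t| ≤ C) (hty : |dist z y - (dist o y - t)| ≤ C) :
    t - C - dist z ζ ≤ gromovProduct o y ζ := by
  have hoz := dist_triangle_right o z ζ
  have hyζ := dist_triangle_left y ζ z
  rw [abs_le] at ht hty
  simp only [gromovProduct]
  linarith [ht.1, hty.2]

variable [ProperSpace X]

/-- The point `ζ` is the ultralimit of points at a fixed distance from `o` on coarse segments
from `o` to the points of `U`. -/
theorem exists_eventually_le_gromovProduct (hgeod : IsCoarselyGeodesic X) (U : Ultrafilter X)
    (hU : (U : Filter X) ≤ Bornology.cobounded X) (o : X) (R : ℝ) :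
    ∃ ζ, ∀ᶠ y in U, R ≤ gromovProduct o y ζ := by
  obtain ⟨C, hC⟩ := hgeod
  obtain ⟨t, ht0, hRt⟩ : ∃ t, 0 ≤ t ∧ R + C + 1 ≤ t := ⟨_, le_max_left _ _, le_max_right _ _⟩
  have hfar : ∀ᶠ y in U, t ≤ dist o y :=
    hU ((Metric.tendsto_dist_left_cobounded_atTop o).eventually_ge_atTop t)
  choose! z hoz hzy using fun y (hy : t ≤ dist o y) => hC o y t ⟨ht0, hy⟩
  obtain ⟨ζ, -, hζ⟩ := exists_tendsto_of_eventually_mem_isCompact U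
    (isCompact_closedBall o (t + C)) (f := z) <| hfar.mono fun y hy => by
      rw [Metric.mem_closedBall']
      linarith [(abs_le.1 (hoz y hy)).2]
  refine ⟨ζ, ?_⟩
  filter_upwards [hfar, hζ (Metric.ball_mem_nhds ζ one_pos)] with y hy hzζ
  linarith [sub_le_gromovProduct_of_coarse_mem_segment ζ (hoz y hy) (hzy y hy),
    Metric.mem_ball.1 hzζ]

theorem exists_asymptoticAtInfinity_of_not_isBounded (hX : IsGromovHyperbolic δ o)
    (hgeod : IsCoarselyGeodesic X) {L : Set X} (hL : ¬ Bornology.IsBounded L) :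
    ∃ u : ℕ → X, (∀ n, u n ∈ L) ∧ AsymptoticAtInfinity o u u := by
  have : NeBot (Bornology.cobounded X ⊓ 𝓟 L) := frequently_mem_iff_neBot.1 fun h => hL h
  let U : Ultrafilter X := Ultrafilter.of (Bornology.cobounded X ⊓ 𝓟 L)
  have hU := le_inf_iff.1 (Ultrafilter.of_le (Bornology.cobounded X ⊓ 𝓟 L))
  choose ζ hζ using fun R : ℕ => exists_eventually_le_gromovProduct hgeod U hU.1 o R
  have hnear : ∀ m : ℕ, ∀ᶠ y in U, ∀ R ∈ Set.Iic m, R ≤ gromovProduct o y (ζ R) := fun m =>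
    (Set.finite_Iic m).eventually_all.2 fun R _ => hζ R
  choose u huL hu using fun m => ((eventually_principal.2 fun _ => id).filter_mono hU.2 |>.and
    (hnear m)).exists
  refine ⟨u, huL, tendsto_atTop.2 fun b => ?_⟩
  obtain ⟨R, hR⟩ := exists_nat_ge (b + δ)
  filter_upwards [eventually_ge_atTop (R, R)] with p hp
  linarith [hX.2 (u p.1) (u p.2) (ζ R), le_min (hu p.1 R hp.1) (hu p.2 R hp.2)]

end Hyperbolic

/-! ### Displacement -/

section Displacement

variable {G X : Type*} [Group G] [MetricSpace X] {S : Finset G}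

theorem dist_le_maxDisplacement (ρ : G →* (X ≃ᵢ X)) (x : X) {g : G} (hg : g ∈ S) :
    dist x (ρ g x) ≤ maxDisplacement S ρ x :=
  NNReal.coe_le_coe.2 (Finset.le_sup (f := fun g => nndist x (ρ g x)) hg)

theorem continuous_maxDisplacement (S : Finset G) (ρ : G →* (X ≃ᵢ X)) :
    Continuous (maxDisplacement S ρ) :=
  Continuous.finset_sup_apply fun g _ => continuous_id.nndist (ρ g).continuous

theorem maxDisplacement_conjRep (ρ : G →* (X ≃ᵢ X)) (φ : X ≃ᵢ X) (x : X) :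
    maxDisplacement S (conjRep ρ φ) (φ x) = maxDisplacement S ρ x := by
  simp [maxDisplacement, conjRep, φ.isometry.nndist_eq]

/-- The factor `N` is the word length of `g`. -/
theorem exists_dist_le_mul_maxDisplacement (hS : Subgroup.closure (S : Set G) = ⊤) (g : G) :
    ∃ N : ℝ≥0, ∀ (ρ : G →* (X ≃ᵢ X)) (x : X), dist x (ρ g x) ≤ N * maxDisplacement S ρ x := by
  have hg : g ∈ Subgroup.closure (S : Set G) := hS ▸ Subgroup.mem_top g
  induction hg using Subgroup.closure_induction with
  | mem g hg => exact ⟨1, fun ρ x => by simpa using dist_le_maxDisplacement ρ x hg⟩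
  | one => exact ⟨0, fun ρ x => by simp⟩
  | mul g h _ _ hg hh =>
    obtain ⟨N, hN⟩ := hg
    obtain ⟨M, hM⟩ := hh
    refine ⟨N + M, fun ρ x => ?_⟩
    calc dist x (ρ (g * h) x) ≤ dist x (ρ g x) + dist (ρ g x) (ρ g (ρ h x)) := by
          rw [map_mul]
          exact dist_triangle _ _ _
      _ = dist x (ρ g x) + dist x (ρ h x) := by rw [IsometryEquiv.dist_eq]
      _ ≤ N * maxDisplacement S ρ x + M * maxDisplacement S ρ x := add_le_add (hN ρ x) (hM ρ x)
      _ = (N + M : ℝ≥0) * maxDisplacement S ρ x := by rw [NNReal.coe_add, add_mul]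
  | inv g _ hg =>
    refine hg.imp fun N hN ρ x => ?_
    rw [← (ρ g).dist_eq, ← IsometryEquiv.mul_apply, ← map_mul, mul_inv_cancel, map_one,
      IsometryEquiv.coe_one, id, dist_comm]
    exact hN ρ x

theorem maxDisplacement_pos_iff (hS : Subgroup.closure (S : Set G) = ⊤) (ρ : G →* (X ≃ᵢ X))
    (x : X) : 0 < maxDisplacement S ρ x ↔ ∃ g, ρ g x ≠ x := by
  refine ⟨fun hpos => ?_, fun ⟨g, hg⟩ => pos_iff_ne_zero.2 fun hzero => hg ?_⟩
  · by_contra! hfix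
    simp [maxDisplacement, hfix] at hpos
  · obtain ⟨N, hN⟩ := exists_dist_le_mul_maxDisplacement (X := X) hS g
    have hle := hN ρ x
    rw [hzero, NNReal.coe_zero, mul_zero] at hle
    exact (dist_le_zero.1 hle).symm

variable [ProperSpace X] {δ : ℝ} {o : X} {ρ : G →* (X ≃ᵢ X)}

theorem IsNonElementary.isBounded_maxDisplacement_le (hρ : IsNonElementary o ρ)
    (hX : IsGromovHyperbolic δ o) (hgeod : IsCoarselyGeodesic X)
    (hS : Subgroup.closure (S : Set G) = ⊤) (M : ℝ≥0) :
    Bornology.IsBounded {x | maxDisplacement S ρ x ≤ M} := by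
  by_contra hunbounded
  obtain ⟨u, huM, hu⟩ := exists_asymptoticAtInfinity_of_not_isBounded hX hgeod hunbounded
  refine hρ ⟨u, hu, fun g => ?_⟩
  obtain ⟨N, hN⟩ := exists_dist_le_mul_maxDisplacement (X := X) hS g
  refine hu.of_dist_le (D := N * M) fun n => (hN ρ (u n)).trans ?_
  gcongr
  exact huM n

theorem IsNonElementary.exists_isCentrallyLocated (hρ : IsNonElementary o ρ)
    (hX : IsGromovHyperbolic δ o) (hgeod : IsCoarselyGeodesic X)
    (hS : Subgroup.closure (S : Set G) = ⊤) : ∃ x : X, IsCentrallyLocated S ρ x :=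
  (continuous_maxDisplacement S ρ).exists_forall_le_of_isBounded o
    (hρ.isBounded_maxDisplacement_le hX hgeod hS _)

end Displacement

/-! ### Limits of representations -/

theorem tendsto_isomToContinuousMap {ι X : Type*} [MetricSpace X] {l : Filter ι}
    {f : ι → (X ≃ᵢ X)} {F : X ≃ᵢ X} (h : ∀ x, Tendsto (fun i => f i x) l (𝓝 (F x))) :
    Tendsto (fun i => isomToContinuousMap (f i)) l (𝓝 (isomToContinuousMap F)) := by
  have hequi : UniformEquicontinuous fun i => (f i : X → X) :=
    LipschitzWith.uniformEquicontinuous _ 1 fun i => (f i).isometry.lipschitz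
  have hunif := (EquicontinuousOn.tendsto_uniformOnFun_iff_pi (𝔖 := {K : Set X | IsCompact K})
    (fun _ => id) Set.sUnion_isCompact_eq_univ
    (fun K _ => hequi.equicontinuous.equicontinuousOn K) l F).2 (tendsto_pi_nhds.2 h)
  exact ContinuousMap.tendsto_iff_forall_isCompact_tendstoUniformlyOn.2
    (UniformOnFun.tendsto_iff_tendstoUniformlyOn.1 hunif)

theorem exists_tendsto_rep {ι G X : Type*} [Group G] [MetricSpace X] [ProperSpace X]
    (U : Ultrafilter ι) (σ : ι → G →* (X ≃ᵢ X)) (o : X)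
    (hσ : ∀ g, ∃ N : ℝ, ∀ i, dist o (σ i g o) ≤ N) :
    ∃ τ : G →* (X ≃ᵢ X), ∀ g x, Tendsto (fun i => σ i g x) U (𝓝 (τ g x)) := by
  have hlim : ∀ g x, ∃ y, Tendsto (fun i => σ i g x) U (𝓝 y) := fun g x => by
    obtain ⟨N, hN⟩ := hσ g
    refine (exists_tendsto_of_eventually_mem_isCompact U
      (isCompact_closedBall o (N + dist o x)) (Eventually.of_forall fun i => ?_)).imp
      fun _ => And.right
    rw [Metric.mem_closedBall']
    calc dist o (σ i g x) ≤ dist o (σ i g o) + dist (σ i g o) (σ i g x) := dist_triangle _ _ _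
      _ ≤ N + dist o x := add_le_add (hN i) (IsometryEquiv.dist_eq _ _ _).le
  choose t ht using hlim
  refine ⟨isometryRep t (fun g => Isometry.of_dist_eq fun x y => ?_) (fun x => ?_)
    (fun g h x => ?_), ht⟩
  · exact tendsto_nhds_unique ((ht g x).dist (ht g y)) (by simp [IsometryEquiv.dist_eq])
  · exact tendsto_nhds_unique (ht 1 x) (by simp)
  · refine dist_eq_zero.1 (tendsto_nhds_unique ((ht (g * h) x).dist (ht g (t h x))) ?_)
    simpa [IsometryEquiv.dist_eq] using tendsto_iff_dist_tendsto_zero.1 (ht h x)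

theorem exists_subseq_convergesCompactOpen {G X : Type*} [Group G] [Countable G] [MetricSpace X]
    [ProperSpace X] (σ : ℕ → G →* (X ≃ᵢ X)) (o : X)
    (hσ : ∀ g, ∃ N : ℝ, ∀ i, dist o (σ i g o) ≤ N) :
    ∃ (k : ℕ → ℕ) (τ : G →* (X ≃ᵢ X)), StrictMono k ∧
      ConvergesCompactOpen (fun i => σ (k i)) τ := by
  obtain ⟨τ, hτ⟩ := exists_tendsto_rep (hyperfilter ℕ) σ o hσ
  obtain ⟨k, hk, hkτ⟩ := exists_subseq_tendsto_of_tendsto_hyperfilter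
    (tendsto_pi_nhds.2 fun g => tendsto_isomToContinuousMap (hτ g))
  exact ⟨k, τ, hk, tendsto_pi_nhds.1 hkτ⟩

theorem dist_apply_le_of_isometryEquiv {X : Type*} [MetricSpace X] (f : X ≃ᵢ X) (o p : X) :
    dist o (f o) ≤ 2 * dist o p + dist p (f p) := by
  have h := dist_triangle4 o p (f p) (f o)
  rw [f.dist_eq, dist_comm p o] at h
  linarith

theorem IsomActsCocompactly.exists_isCompact_forall_exists_apply_mem {X : Type*} [MetricSpace X]
    (hX : IsomActsCocompactly X) : ∃ K : Set X, IsCompact K ∧ ∀ x, ∃ φ : X ≃ᵢ X, φ x ∈ K := by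
  refine hX.imp fun K ⟨hK, hcover⟩ => ⟨hK, fun x => ?_⟩
  obtain ⟨φ, p, hp, rfl⟩ := Set.mem_iUnion.1 (hcover.symm ▸ Set.mem_univ x)
  exact ⟨φ.symm, by rwa [φ.symm_apply_apply]⟩

theorem exists_subseq_conjRep_convergesCompactOpen {G X : Type*} [Group G] [MetricSpace X]
    [ProperSpace X] (hX : IsomActsCocompactly X) {S : Finset G}
    (hS : Subgroup.closure (S : Set G) = ⊤) (ρ : ℕ → G →* (X ≃ᵢ X)) (x : ℕ → X) {M : ℝ≥0}
    (hM : ∀ i, maxDisplacement S (ρ i) (x i) ≤ M) :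
    ∃ (k : ℕ → ℕ) (φ : ℕ → (X ≃ᵢ X)) (τ : G →* (X ≃ᵢ X)), StrictMono k ∧
      ConvergesCompactOpen (fun i => conjRep (ρ (k i)) (φ i)) τ := by
  have : Countable G := countable_of_closure_eq_top hS
  obtain ⟨K, hK, hcover⟩ := hX.exists_isCompact_forall_exists_apply_mem
  choose φ hφ using fun i => hcover (x i)
  obtain ⟨D, hD⟩ := hK.isBounded.subset_closedBall (x 0)
  have hbounded : ∀ g, ∃ N : ℝ, ∀ i, dist (x 0) (conjRep (ρ i) (φ i) g (x 0)) ≤ N := fun g => by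
    obtain ⟨N, hN⟩ := exists_dist_le_mul_maxDisplacement (X := X) hS g
    refine ⟨2 * D + N * M, fun i => (dist_apply_le_of_isometryEquiv _ _ (φ i (x i))).trans ?_⟩
    gcongr
    · exact Metric.mem_closedBall'.1 (hD (hφ i))
    · refine (hN _ _).trans ?_
      rw [maxDisplacement_conjRep]
      gcongr
      exact hM i
  obtain ⟨k, τ, hk, hτ⟩ := exists_subseq_convergesCompactOpen _ (x 0) hbounded
  exact ⟨k, fun i => φ (k i), τ, hk, hτ⟩

/-! ### Asymptotic cones -/

section AsymptoticCone

open Asymptotics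

variable {ι X : Type*} [PseudoMetricSpace X]

theorem exists_tendsto_div_of_isBigO {U : Ultrafilter ι} {f g : ι → ℝ}
    (hfg : f =O[(U : Filter ι)] g) : ∃ a, Tendsto (fun i => f i / g i) U (𝓝 a) := by
  obtain ⟨C, hC⟩ := div_isBoundedUnder_of_isBigO hfg
  obtain ⟨a, -, ha⟩ := exists_tendsto_of_eventually_mem_isCompact U
    (isCompact_closedBall (0 : ℝ) C) (f := fun i => f i / g i) <|
      (eventually_map.1 hC).mono fun i hi => mem_closedBall_zero_iff.2 hi
  exact ⟨a, ha⟩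

theorem tendsto_div_of_abs_sub_le {l : Filter ι} {r : ι → ℝ≥0} (hr : Tendsto r l atTop)
    {f f' : ι → ℝ} {a C : ℝ} (hf : Tendsto (fun i => f i / r i) l (𝓝 a))
    (hC : ∀ i, |f' i - f i| ≤ C) : Tendsto (fun i => f' i / r i) l (𝓝 a) := by
  have hsmall : Tendsto (fun i => C / r i) l (𝓝 0) :=
    tendsto_const_nhds.div_atTop (NNReal.tendsto_coe_atTop.2 hr)
  refine hf.congr_dist (squeeze_zero (fun _ => dist_nonneg) (fun i => ?_) hsmall)
  rw [dist_comm, Real.dist_eq, ← sub_div, abs_div, NNReal.abs_eq]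
  gcongr
  exact hC i

theorem isBigO_dist_trans {l : Filter ι} {r : ι → ℝ} {u v w : ι → X}
    (huv : (fun i => dist (u i) (v i)) =O[l] r) (hvw : (fun i => dist (v i) (w i)) =O[l] r) :
    (fun i => dist (u i) (w i)) =O[l] r :=
  (IsBigO.of_norm_le fun i => by
    rw [Real.norm_of_nonneg dist_nonneg]
    exact dist_triangle (u i) (v i) (w i)).trans (huv.add hvw)

/-- The sequences of points of `X` at distance `O(r i)` from the basepoints `x i`, for almost all
indices with respect to the ultrafilter `U`. -/
@[ext]
structure ConePoint (U : Ultrafilter ι) (x : ι → X) (r : ι → ℝ≥0) where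
  toFun : ι → X
  isBigO : (fun i => dist (x i) (toFun i)) =O[(U : Filter ι)] fun i => (r i : ℝ)

variable {U : Ultrafilter ι} {x : ι → X} {r : ι → ℝ≥0}

namespace ConePoint

instance : CoeFun (ConePoint U x r) fun _ => ι → X := ⟨ConePoint.toFun⟩

/-- The ultralimit of the distances rescaled by `1 / r i`. -/
noncomputable instance : Dist (ConePoint U x r) :=
  ⟨fun z w => limUnder (U : Filter ι) fun i => dist (z i) (w i) / r i⟩

theorem tendsto_dist (z w : ConePoint U x r) :
    Tendsto (fun i => dist (z i) (w i) / r i) U (𝓝 (dist z w)) := by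
  have hz : (fun i => dist (z i) (x i)) =O[(U : Filter ι)] fun i => (r i : ℝ) := by
    simpa only [dist_comm] using z.isBigO
  exact tendsto_nhds_limUnder (exists_tendsto_div_of_isBigO (isBigO_dist_trans hz w.isBigO))

noncomputable instance : PseudoMetricSpace (ConePoint U x r) where
  dist_self z := tendsto_nhds_unique (tendsto_dist z z) (by simp)
  dist_comm z w := tendsto_nhds_unique (tendsto_dist z w)
    (by simpa only [dist_comm] using tendsto_dist w z)
  dist_triangle z w v := le_of_tendsto_of_tendsto' (tendsto_dist z v)
    ((tendsto_dist z w).add (tendsto_dist w v)) fun i => by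
      rw [← add_div]
      gcongr
      exact dist_triangle _ _ _

/-- The sequence of basepoints. -/
def base (U : Ultrafilter ι) (x : ι → X) (r : ι → ℝ≥0) : ConePoint U x r :=
  ⟨x, by simpa only [dist_self] using isBigO_zero _ _⟩

variable {G : Type*} [Group G] (ρ : ι → G →* (X ≃ᵢ X))
  (hρ : ∀ g, (fun i => dist (x i) (ρ i g (x i))) =O[(U : Filter ι)] fun i => (r i : ℝ))

/-- The termwise action on sequences. -/
def act (g : G) (z : ConePoint U x r) : ConePoint U x r :=
  ⟨fun i => ρ i g (z i),
    isBigO_dist_trans (hρ g) (by simpa only [IsometryEquiv.dist_eq] using z.isBigO)⟩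

theorem isometry_act (g : G) : Isometry (act ρ hρ g) :=
  Isometry.of_dist_eq fun z w => tendsto_nhds_unique (tendsto_dist _ _)
    (by simpa only [act, IsometryEquiv.dist_eq] using tendsto_dist z w)

theorem act_one (z : ConePoint U x r) : act ρ hρ 1 z = z :=
  ConePoint.ext (funext fun i => by simp [act])

theorem act_mul (g h : G) (z : ConePoint U x r) :
    act ρ hρ (g * h) z = act ρ hρ g (act ρ hρ h z) :=
  ConePoint.ext (funext fun i => by simp [act])

end ConePoint

/-- The asymptotic cone of `X` along `U` with observation centers `x i` and scales `r i`:
sequences of points modulo distance `o(r i)`. -/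
abbrev AsymptoticCone (U : Ultrafilter ι) (x : ι → X) (r : ι → ℝ≥0) : Type _ :=
  SeparationQuotient (ConePoint U x r)

namespace AsymptoticCone

open SeparationQuotient

theorem tendsto_dist_mk (z w : ConePoint U x r) :
    Tendsto (fun i => dist (z i) (w i) / r i) U (𝓝 (dist (mk z) (mk w))) :=
  ConePoint.tendsto_dist z w

theorem fourPointCondition {ε : ℝ} (hX : ∀ x y z w : X,
    dist x y + dist z w ≤ max (dist x z + dist y w) (dist x w + dist y z) + ε)
    (hr : Tendsto r U atTop) : FourPointCondition (AsymptoticCone U x r) := by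
  simp only [FourPointCondition, surjective_mk.forall]
  intro a b c d
  have hsmall : Tendsto (fun i => ε / r i) U (𝓝 0) :=
    tendsto_const_nhds.div_atTop (NNReal.tendsto_coe_atTop.2 hr)
  have hlim := (((tendsto_dist_mk a c).add (tendsto_dist_mk b d)).max
    ((tendsto_dist_mk a d).add (tendsto_dist_mk b c))).add hsmall
  rw [add_zero] at hlim
  refine le_of_tendsto_of_tendsto' ((tendsto_dist_mk a b).add (tendsto_dist_mk c d)) hlim
    fun i => ?_
  simp only [← add_div]
  rw [max_div_div_right (r i).coe_nonneg, ← add_div]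
  exact div_le_div_of_nonneg_right (hX _ _ _ _) (r i).coe_nonneg

/-- A point at distance `t` from `mk z` on the way to `mk w` is represented by points at distance
about `t * r i` from `z i` on coarse segments from `z i` to `w i`. -/
theorem hasIntermediatePoints {X : Type*} [MetricSpace X] {x : ι → X}
    (hX : IsCoarselyGeodesic X) (hr : Tendsto r U atTop) :
    HasIntermediatePoints (AsymptoticCone U x r) := by
  obtain ⟨C, hC⟩ := hX
  simp only [HasIntermediatePoints, surjective_mk.forall]
  rintro z w t ⟨ht0, htd⟩
  choose u hzu huw using fun i => hC (z i) (w i) (min (t * r i) (dist (z i) (w i)))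
    ⟨le_min (mul_nonneg ht0 (r i).coe_nonneg) dist_nonneg, min_le_right _ _⟩
  have hr0 : ∀ᶠ i in U, (r i : ℝ) ≠ 0 := (hr.eventually_ne_atTop 0).mono fun i => by simp
  have hmin : Tendsto (fun i => min (t * r i) (dist (z i) (w i)) / r i) U (𝓝 t) := by
    have hlim := (tendsto_const_nhds (x := t)).min (tendsto_dist_mk z w)
    rw [min_eq_left htd] at hlim
    refine hlim.congr' (hr0.mono fun i hi => ?_)
    simp only [← min_div_div_right (r i).coe_nonneg, mul_div_cancel_right₀ _ hi]
  have hdist := tendsto_div_of_abs_sub_le hr hmin hzu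
  have hu : (fun i => dist (z i) (u i)) =O[(U : Filter ι)] fun i => (r i : ℝ) :=
    isBigO_of_div_tendsto_nhds (hr0.mono fun i hi h => absurd h hi) t hdist
  refine ⟨mk ⟨u, isBigO_dist_trans z.isBigO hu⟩, tendsto_nhds_unique (tendsto_dist_mk _ _) hdist,
    tendsto_nhds_unique (tendsto_dist_mk _ _) (tendsto_div_of_abs_sub_le hr ?_ huw)⟩
  simpa only [sub_div] using (tendsto_dist_mk z w).sub hmin

section Action

variable {G : Type*} [Group G] (ρ : ι → G →* (X ≃ᵢ X))
  (hρ : ∀ g, (fun i => dist (x i) (ρ i g (x i))) =O[(U : Filter ι)] fun i => (r i : ℝ))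

/-- The limiting action on the asymptotic cone. -/
noncomputable def rep : G →* (AsymptoticCone U x r ≃ᵢ AsymptoticCone U x r) :=
  isometryRep (fun g => SeparationQuotient.map (ConePoint.act ρ hρ g))
    (fun g => Isometry.of_dist_eq <| surjective_mk.forall₂.2 fun z w => by
      simp only [map_mk (ConePoint.isometry_act ρ hρ g).uniformContinuous, dist_mk,
        (ConePoint.isometry_act ρ hρ g).dist_eq])
    (surjective_mk.forall.2 fun z => by
      rw [map_mk (ConePoint.isometry_act ρ hρ 1).uniformContinuous, ConePoint.act_one])
    (fun g h => surjective_mk.forall.2 fun z => by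
      simp only [map_mk (ConePoint.isometry_act ρ hρ _).uniformContinuous, ConePoint.act_mul])

theorem rep_mk (g : G) (z : ConePoint U x r) :
    rep ρ hρ g (mk z) = mk (ConePoint.act ρ hρ g z) :=
  map_mk (ConePoint.isometry_act ρ hρ g).uniformContinuous z

theorem tendsto_dist_rep (g h : G) (z : ConePoint U x r) :
    Tendsto (fun i => dist (ρ i g (z i)) (ρ i h (z i)) / r i) U
      (𝓝 (dist (rep ρ hρ g (mk z)) (rep ρ hρ h (mk z)))) := by
  rw [rep_mk, rep_mk]
  exact tendsto_dist_mk _ _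

end Action

theorem exists_rep_apply_ne {G X : Type*} [Group G] [MetricSpace X] {x : ι → X} {S : Finset G}
    (ρ : ι → G →* (X ≃ᵢ X))
    (hρ : ∀ g, (fun i => dist (x i) (ρ i g (x i))) =O[(U : Filter ι)] fun i => (r i : ℝ))
    (hr : ∀ i, 0 < r i) (hle : ∀ i z, r i ≤ maxDisplacement S (ρ i) z)
    (y : AsymptoticCone U x r) : ∃ g, rep ρ hρ g y ≠ y := by
  obtain ⟨z, rfl⟩ := surjective_mk y
  by_contra! hfix
  have hsmall : ∀ g ∈ S, ∀ᶠ i in U, dist (z i) (ρ i g (z i)) / r i < 1 := fun g _ => by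
    have hlim := tendsto_dist_rep ρ hρ 1 g z
    rw [hfix, hfix, dist_self] at hlim
    simpa using hlim.eventually_lt_const one_pos
  obtain ⟨i, hi⟩ := ((Finset.eventually_all S).2 hsmall).exists
  refine (hle i (z i)).not_gt ((Finset.sup_lt_iff (hr i)).2 fun g hg => ?_)
  exact NNReal.coe_lt_coe.1 ((div_lt_one (NNReal.coe_pos.2 (hr i))).1 (hi g hg))

end AsymptoticCone

end AsymptoticCone

/-! ### Convergence of based `G`-spaces -/

theorem IsEquivariantDist.const_mul {G : Type*} [Group G] {d : G → G → ℝ}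
    (hd : IsEquivariantDist d) {c : ℝ} (hc : 0 < c) : IsEquivariantDist fun a b => c * d a b where
  nonneg a b := mul_nonneg hc.le (hd.nonneg a b)
  self a := by rw [hd.self, mul_zero]
  symm a b := by rw [hd.symm]
  triangle a b e := by
    rw [← mul_add]
    exact mul_le_mul_of_nonneg_left (hd.triangle a b e) hc.le
  equivariant g a b := by rw [hd.equivariant]
  nonzero := by
    obtain ⟨a, b, hab⟩ := hd.nonzero
    exact ⟨a, b, mul_ne_zero hc.ne' hab⟩

theorem BasedGSpace.convergesTo_of_tendsto_mul {G T : Type*} {X : ℕ → Type*} [Group G]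
    [∀ i, MetricSpace (X i)] [MetricSpace T] (A : ∀ i, BasedGSpace G (X i)) (B : BasedGSpace G T)
    {c : ℕ → ℝ} (hc : ∀ i, 0 < c i)
    (h : Tendsto (fun i a b => c i * (A i).inducedDist.1 a b) atTop (𝓝 B.inducedDist.1)) :
    BasedGSpace.ConvergesTo A B := by
  let e : ℕ → EquivDist G := fun i => ⟨_, (A i).inducedDist.2.const_mul (hc i)⟩
  have he : Tendsto e atTop (𝓝 B.inducedDist) := tendsto_subtype_rng.2 h
  have hmk : Continuous (Quotient.mk (equivDistSetoid G)) := continuous_quot_mk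
  refine ((hmk.tendsto _).comp he).congr fun i => ?_
  have hequiv : (A i).inducedDist ≈ e i := ⟨c i, hc i, fun _ _ => rfl⟩
  exact (Quotient.sound hequiv).symm

theorem exists_subseq_convergesTo_rTree {G : Type u} {X : Type v} [Group G] [MetricSpace X]
    {δ : ℝ} {o : X} (hX : IsGromovHyperbolic δ o) (hgeod : IsCoarselyGeodesic X)
    {S : Finset G} (hS : Subgroup.closure (S : Set G) = ⊤)
    (A : ℕ → BasedGSpace G X) (hA : ∀ i, IsCentrallyLocated S (A i).action (A i).base)
    (hdiv : Tendsto (fun i => maxDisplacement S (A i).action (A i).base) atTop atTop) :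
    ∃ k : ℕ → ℕ, StrictMono k ∧ ∃ (T : Type u) (_ : MetricSpace T) (B : BasedGSpace G T),
      IsRTree T ∧ BasedGSpace.ConvergesTo (fun i => A (k i)) B ∧
      ∀ t : T, ∃ g : G, B.action g t ≠ t := by
  have : Countable G := countable_of_closure_eq_top hS
  let x i := (A i).base
  let ρ i := (A i).action
  let r i := maxDisplacement S (ρ i) (x i)
  have hr : ∀ i, 0 < r i := fun i => (maxDisplacement_pos_iff hS _ _).2 (A i).base_moved
  have hrU : Tendsto r (hyperfilter ℕ) atTop := hdiv.mono_left Nat.hyperfilter_le_atTop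
  have hρ : ∀ g, (fun i => dist (x i) (ρ i g (x i))) =O[(hyperfilter ℕ : Filter ℕ)]
      fun i => (r i : ℝ) := fun g => by
    obtain ⟨N, hN⟩ := exists_dist_le_mul_maxDisplacement (X := X) hS g
    exact Asymptotics.IsBigO.of_bound N (Eventually.of_forall fun i => by simpa using hN _ _)
  let p : AsymptoticCone (hyperfilter ℕ) x r := SeparationQuotient.mk (ConePoint.base _ x r)
  obtain ⟨T, _, B, hT, hB, hBfix⟩ :=
    (AsymptoticCone.fourPointCondition hX.four_point hrU).exists_orbit_basedGSpace
      (AsymptoticCone.hasIntermediatePoints hgeod hrU) (AsymptoticCone.rep ρ hρ) p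
      (AsymptoticCone.exists_rep_apply_ne ρ hρ hr hA)
  have hlim : Tendsto (fun i g h => (r i : ℝ)⁻¹ * (A i).inducedDist.1 g h) (hyperfilter ℕ)
      (𝓝 B.inducedDist.1) := by
    refine tendsto_pi_nhds.2 fun g => tendsto_pi_nhds.2 fun h => ?_
    rw [hB]
    refine (AsymptoticCone.tendsto_dist_rep ρ hρ g h _).congr fun i => ?_
    rw [inv_mul_eq_div]
    rfl
  obtain ⟨k, hk, hkB⟩ := exists_subseq_tendsto_of_tendsto_hyperfilter hlim
  exact ⟨k, hk, T, _, B, hT, BasedGSpace.convergesTo_of_tendsto_mul _ B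
    (fun i => inv_pos.2 (NNReal.coe_pos.2 (hr (k i)))) hkB, hBfix⟩

theorem mainTheorem4 {G : Type u} [Group G] {X : Type v} [MetricSpace X] [ProperSpace X]
    (δ : ℝ) (o : X) (hX : IsGromovHyperbolic δ o) (hgeod : IsCoarselyGeodesic X)
    (hcocompact : IsomActsCocompactly X)
    (S : Finset G) (hS : Subgroup.closure (S : Set G) = ⊤)
    (ρ : ℕ → G →* (X ≃ᵢ X)) (hρ : ∀ i, IsNonElementary o (ρ i)) :
    ∃ k : ℕ → ℕ, StrictMono k ∧
      ((∃ (φ : ℕ → (X ≃ᵢ X)) (τ : G →* (X ≃ᵢ X)),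
          ConvergesCompactOpen (fun i => conjRep (ρ (k i)) (φ i)) τ) ∨
        (∃ (x : ℕ → X) (hx : ∀ i, ∃ g : G, ρ (k i) g (x i) ≠ x i),
          (∀ i, IsCentrallyLocated S (ρ (k i)) (x i)) ∧
          ∃ (T : Type u) (_ : MetricSpace T) (B : BasedGSpace G T),
            IsRTree T ∧
            BasedGSpace.ConvergesTo (X := fun _ => X)
              (fun i => ⟨ρ (k i), x i, hx i⟩) B ∧
            ∀ t : T, ∃ g : G, B.action g t ≠ t)) := by
  choose x hx using fun i => (hρ i).exists_isCentrallyLocated hX hgeod hS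
  obtain ⟨M, j, hj, hM⟩ | hdiv :=
    exists_subseq_le_or_tendsto_atTop fun i => maxDisplacement S (ρ i) (x i)
  · obtain ⟨k, φ, τ, hk, hτ⟩ := exists_subseq_conjRep_convergesCompactOpen hcocompact hS
      (fun i => ρ (j i)) (fun i => x (j i)) hM
    exact ⟨j ∘ k, hj.comp hk, Or.inl ⟨φ, τ, hτ⟩⟩
  · obtain ⟨j, hj, hpos⟩ := extraction_of_eventually_atTop (hdiv.eventually_gt_atTop 0)
    have hmoved i : ∃ g, ρ (j i) g (x (j i)) ≠ x (j i) :=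
      (maxDisplacement_pos_iff hS _ _).1 (hpos i)
    obtain ⟨k, hk, hT⟩ := exists_subseq_convergesTo_rTree hX hgeod hS
      (fun i => ⟨ρ (j i), x (j i), hmoved i⟩) (fun i => hx (j i)) (hdiv.comp hj.tendsto_atTop)
    exact ⟨j ∘ k, hj.comp hk, Or.inr ⟨fun i => x (j (k i)), fun i => hmoved (k i),
      fun i => hx (j (k i)), hT⟩⟩
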